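/- **Theorem 5.1.** Let $p\ge 0$ be an integer, $[p]=\{1,\dots,p\}$, and let $$F_{p,1}=\{\Sigma+\lambda\lambda^{t}\;:\;\Sigma\in\mathbb R^{p\times p}\text{ diagonal and positive definite},\ \lambda\in\mathbb R^{p}\}$$ be the parameter space of the one-factor analysis model with $p$ observed variables. A one-factor invariant is a polynomial $f\in\mathbb R[\psi_{ij},\,i\le j]$ with $f(\Psi)=0$ for all $\Psi\in F_{p,1}$; let $I(F_{p,1})$ be the ideal of all of them and $I_{p,1}=I(F_{p,1})\cap\mathbb R[\psi_{ij},\,i<j]$. Let $$\mathcal T_p=\{\psi_{ij}\psi_{k\ell}-\psi_{ik}\psi_{j\ell},\ \ \psi_{i\ell}\psi_{jk}-\psi_{ik}\psi_{j\ell}\;:\;1\le i<j<k<\ell\le p\}$$ be the set of tetrads. Place the vertices $1,\dots,p$ of the complete graph $K_p$ in this cyclic order on a circle, draw the edges as closed straight chords, and let the weight of $\psi_{ij}$ be the number of edges of $K_p$ that do not meet the edge $\{i,j\}$ (edges with a common endpoint meet). A thrackle order is a monomial order on $\mathbb R[\psi_{ij},\,i<j]$ for which, of two monomials of different weight, the one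 of larger weight is larger. Then: 1. If $p\le 3$, then $I_{p,1}=0$. 2. If $p\ge 4$, then $\mathcal T_p$ has exactly $2\binom p4$ elements; thrackle orders exist; and for every thrackle order the leading terms of $\psi_{ij}\psi_{k\ell}-\psi_{ik}\psi_{j\ell}$ and $\psi_{i\ell}\psi_{jk}-\psi_{ik}\psi_{j\ell}$ (where $i<j<k<\ell$) are $\psi_{ij}\psi_{k\ell}$ and $\psi_{i\ell}\psi_{jk}$, and $\mathcal T_p$ is the reduced Gröbner basis of $I_{p,1}$. More generally, $\mathcal T_p$ is the reduced Gröbner basis of $I_{p,1}$ with respect to every monomial order for which these are the leading terms. 3. Consequently, for every $p$, the set $\mathcal T_p$ generates the ideal $I_{p,1}$ of $\mathbb R[\psi_{ij},\,i<j]$, and it generates the ideal $I(F_{p,1})$ of $\mathbb R[\psi_{ij},\,i\le j]$; that is, the one-factor invariants are exactly the polynomial combinations of tetrads. -/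

import Mathlib

open MvPolynomial

universe u

noncomputable section

namespace FactorAnalysis

/-- Parameter space `F_{p,m}` of the factor analysis model with `p` observed and `m` hidden
variables: all covariance matrices `Σ + Λ Λᵗ` with `Σ` diagonal and positive definite and `Λ` an
arbitrary real `p × m` matrix. -/
def parameterSpace (p m : ℕ) : Set (Matrix (Fin p) (Fin p) ℝ) :=
  {Ψ | ∃ (S : Matrix (Fin p) (Fin p) ℝ) (L : Matrix (Fin p) (Fin m) ℝ),
    S.IsDiag ∧ S.PosDef ∧ Ψ = S + L * L.transpose}

/-- Indices of the unknowns `ψ_{ij}` with `i ≤ j`. -/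
abbrev UpperIndex (p : ℕ) : Type := {e : Fin p × Fin p // e.1 ≤ e.2}

/-- Indices of the off-diagonal unknowns `ψ_{ij}` with `i < j`; these are also the edges of the
complete graph on `p` vertices. -/
abbrev OffDiagIndex (p : ℕ) : Type := {e : Fin p × Fin p // e.1 < e.2}

/-- The evaluation `f(Ψ)` of a polynomial `f ∈ ℝ[ψ_{ij}, i ≤ j]` at a matrix `Ψ`. -/
def evalAt {p : ℕ} (Ψ : Matrix (Fin p) (Fin p) ℝ) : MvPolynomial (UpperIndex p) ℝ →+* ℝ :=
  MvPolynomial.eval fun e => Ψ e.1.1 e.1.2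

/-- The ideal `I(F)` of all polynomials in `ℝ[ψ_{ij}, i ≤ j]` that vanish on the set `F`. -/
def vanishingIdeal {p : ℕ} (F : Set (Matrix (Fin p) (Fin p) ℝ)) :
    Ideal (MvPolynomial (UpperIndex p) ℝ) where
  carrier := {f | ∀ Ψ ∈ F, evalAt Ψ f = 0}
  add_mem' hf hg Ψ hΨ := by rw [map_add, hf Ψ hΨ, hg Ψ hΨ, add_zero]
  zero_mem' Ψ _ := map_zero _
  smul_mem' c f hf Ψ hΨ := by rw [smul_eq_mul, map_mul, hf Ψ hΨ, mul_zero]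

/-- The inclusion `ℝ[ψ_{ij}, i < j] → ℝ[ψ_{ij}, i ≤ j]` of polynomial rings. -/
def inclusion (p : ℕ) :
    MvPolynomial (OffDiagIndex p) ℝ →ₐ[ℝ] MvPolynomial (UpperIndex p) ℝ :=
  MvPolynomial.rename fun e => ⟨e.1, e.2.le⟩

/-- The ideal of invariants `I_{p,m}`, as an ideal of the subring `ℝ[ψ_{ij}, i < j]`. -/
def invariantIdeal (p m : ℕ) : Ideal (MvPolynomial (OffDiagIndex p) ℝ) :=
  (vanishingIdeal (parameterSpace p m)).comap (inclusion p)

/-- The off-diagonal unknown `ψ_{ij}`, `i < j`. -/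
def psi {p : ℕ} {i j : Fin p} (h : i < j) : MvPolynomial (OffDiagIndex p) ℝ :=
  MvPolynomial.X ⟨(i, j), h⟩

/-- The set `𝒯_p` of tetrads: for all `i < j < k < l`, the two polynomials
`ψ_{ij} ψ_{kl} - ψ_{ik} ψ_{jl}` and `ψ_{il} ψ_{jk} - ψ_{ik} ψ_{jl}`. -/
def tetrads (p : ℕ) : Set (MvPolynomial (OffDiagIndex p) ℝ) :=
  {f | ∃ (i j k l : Fin p) (hij : i < j) (hjk : j < k) (hkl : k < l),
    f = psi hij * psi hkl - psi (hij.trans hjk) * psi (hjk.trans hkl) ∨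
    f = psi ((hij.trans hjk).trans hkl) * psi hjk - psi (hij.trans hjk) * psi (hjk.trans hkl)}

section Thrackle

/-- Place the vertices of the complete graph in cyclic order on a circle and draw edges as closed
straight chords. Two edges meet if they have a common endpoint or cross. -/
def Meets {p : ℕ} (e f : OffDiagIndex p) : Prop :=
  (e.1.1 = f.1.1 ∨ e.1.1 = f.1.2 ∨ e.1.2 = f.1.1 ∨ e.1.2 = f.1.2) ∨
    (e.1.1 < f.1.1 ∧ f.1.1 < e.1.2 ∧ e.1.2 < f.1.2) ∨
    (f.1.1 < e.1.1 ∧ e.1.1 < f.1.2 ∧ f.1.2 < e.1.2)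

/-- The thrackle weight of `ψ_{ij}`: the number of edges of the complete graph that do not meet
the edge `{i, j}`. -/
def thrackleWeight {p : ℕ} (e : OffDiagIndex p) : ℕ :=
  Nat.card {f : OffDiagIndex p // ¬ Meets e f}

/-- A thrackle order is a monomial order on `ℝ[ψ_{ij}, i < j]` that refines the partial order by
thrackle weight: of two monomials of different weight, the one of larger weight is larger. -/
def IsThrackleOrder {p : ℕ} (m : MonomialOrder.{0, u} (OffDiagIndex p)) : Prop :=
  ∀ a b : OffDiagIndex p →₀ ℕ,
    (a.sum fun e n => n * thrackleWeight e) < (b.sum fun e n => n * thrackleWeight e) →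
      m.toSyn a < m.toSyn b

/-- For all `i < j < k < l`, the leading terms of the two tetrads are
`ψ_{ij} ψ_{kl}` and `ψ_{il} ψ_{jk}`, respectively. -/
def HasNoncrossingLeadingTerms {p : ℕ} (m : MonomialOrder.{0, u} (OffDiagIndex p)) : Prop :=
  ∀ (i j k l : Fin p) (hij : i < j) (hjk : j < k) (hkl : k < l),
    m.leadingTerm (psi hij * psi hkl - psi (hij.trans hjk) * psi (hjk.trans hkl)) =
        psi hij * psi hkl ∧
    m.leadingTerm (psi ((hij.trans hjk).trans hkl) * psi hjk -
          psi (hij.trans hjk) * psi (hjk.trans hkl)) =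
        psi ((hij.trans hjk).trans hkl) * psi hjk

end Thrackle

section Groebner

variable {σ : Type*} {K : Type*} [Field K]

/-- `G` is a Gröbner basis of the ideal `I`: a finite subset of `I` whose leading terms generate
the ideal of leading terms of all elements of `I`. -/
def IsGroebnerBasis (m : MonomialOrder σ) (G : Set (MvPolynomial σ K))
    (I : Ideal (MvPolynomial σ K)) : Prop :=
  G.Finite ∧ G ⊆ I ∧
    Ideal.span (m.leadingTerm '' G) = Ideal.span (m.leadingTerm '' (I : Set (MvPolynomial σ K)))

/-- `G` is the reduced Gröbner basis of `I`: a Gröbner basis all of whose elements `g` have leading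
coefficient `1` and contain no monomial lying in the ideal generated by the leading terms of
`G \ {g}`. -/
def IsReducedGroebnerBasis (m : MonomialOrder σ) (G : Set (MvPolynomial σ K))
    (I : Ideal (MvPolynomial σ K)) : Prop :=
  IsGroebnerBasis m G I ∧
    (∀ g ∈ G, m.leadingCoeff g = 1) ∧
    ∀ g ∈ G, ∀ d ∈ g.support,
      MvPolynomial.monomial d (1 : K) ∉ Ideal.span (m.leadingTerm '' (G \ {g}))

end Groebner

end FactorAnalysis

end

/-! The off-diagonal entries of `Σ + λλᵗ` are the products `λᵢλⱼ`, so `I_{p,1}` is the kernel of the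
toric map `ψ_{ij} ↦ x_i x_j`, which sends a monomial, read as a multiset of edges, to its vertex
degrees. A monomial divisible by no leading term of a tetrad contains no two edges that fail to
meet: it is a thrackle.

The key point is combinatorial: a thrackle is determined by its vertex degrees
(`IsThrackle.eq_of_vertexDegree_eq`). Distinct standard monomials thus have distinct images, and no
nonzero invariant is in normal form. Division with remainder then gives the Gröbner basis property
without S-polynomials (`isGroebnerBasis_of_normalForm`). Reducedness is a comparison of quadratic
monomials.

For the full ideal, fix `λ`: the diagonal entries still range freely over infinite intervals, so the
coefficients of an invariant, as a polynomial in the diagonal unknowns, are themselves off-diagonal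
invariants. -/

namespace FactorAnalysis

variable {p : ℕ}

/-! ### Thrackles and their vertex degrees -/

/-- A multiset of edges is a thrackle if any two of its edges meet. -/
def IsThrackle (a : OffDiagIndex p →₀ ℕ) : Prop :=
  ∀ e f, a e ≠ 0 → a f ≠ 0 → Meets e f

/-- Viewed as intervals, edges miss each other exactly when they are separated or strictly nested;
these are the shapes `{ij, kl}` and `{il, jk}`. -/
theorem not_meets_iff {e f : OffDiagIndex p} :
    ¬ Meets e f ↔ e.1.2 < f.1.1 ∨ f.1.2 < e.1.1 ∨
      (e.1.1 < f.1.1 ∧ f.1.2 < e.1.2) ∨ (f.1.1 < e.1.1 ∧ e.1.2 < f.1.2) := by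
  obtain ⟨⟨a, b⟩, hab⟩ := e
  obtain ⟨⟨c, d⟩, hcd⟩ := f
  change a < b at hab
  change c < d at hcd
  simp only [Meets, Fin.lt_def, Fin.ext_iff] at *
  omega

/-- The vertex degrees of a multiset of edges. -/
noncomputable def vertexDegree (a : OffDiagIndex p →₀ ℕ) : Fin p →₀ ℕ :=
  a.sum fun e n => n • (Finsupp.single e.1.1 1 + Finsupp.single e.1.2 1)

theorem vertexDegree_apply (a : OffDiagIndex p →₀ ℕ) (v : Fin p) :
    vertexDegree a v =
      ∑ e, ((if e.1.1 = v then a e else 0) + (if e.1.2 = v then a e else 0)) := by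
  rw [vertexDegree, Finsupp.sum_fintype _ _ (by simp), Finsupp.finsetSum_apply]
  refine Finset.sum_congr rfl fun e _ => ?_
  simp [Finsupp.single_apply]

/-- The number of edges whose smaller endpoint is at most `v`. -/
def lowerCount (a : OffDiagIndex p →₀ ℕ) (v : Fin p) : ℕ :=
  ∑ e with e.1.1 ≤ v, a e

/-- The number of edges whose larger endpoint is at most `v`. -/
def upperCount (a : OffDiagIndex p →₀ ℕ) (v : Fin p) : ℕ :=
  ∑ e with e.1.2 ≤ v, a e

theorem sum_vertexDegree (a : OffDiagIndex p →₀ ℕ) :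
    ∑ v, vertexDegree a v = 2 * ∑ e, a e := by
  simp_rw [vertexDegree_apply]
  rw [Finset.sum_comm, Finset.mul_sum]
  refine Finset.sum_congr rfl fun e _ => ?_
  simp [Finset.sum_add_distrib, two_mul]

theorem sum_vertexDegree_le (a : OffDiagIndex p →₀ ℕ) (v : Fin p) :
    ∑ w with w ≤ v, vertexDegree a w = lowerCount a v + upperCount a v := by
  simp_rw [vertexDegree_apply]
  rw [Finset.sum_comm, lowerCount, upperCount, Finset.sum_filter, Finset.sum_filter,
    ← Finset.sum_add_distrib]
  refine Finset.sum_congr rfl fun e _ => ?_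
  rw [Finset.sum_filter]
  have h (w : Fin p) (x : Fin p) : (if w ≤ v then (if x = w then a e else 0) else 0) =
      if x = w then (if x ≤ v then a e else 0) else 0 := by
    by_cases hx : x = w <;> simp [hx]
  have h' (w : Fin p) : (if w ≤ v then (if e.1.1 = w then a e else 0) +
      (if e.1.2 = w then a e else 0) else 0) =
      (if w ≤ v then (if e.1.1 = w then a e else 0) else 0) +
      (if w ≤ v then (if e.1.2 = w then a e else 0) else 0) := by
    split_ifs <;> simp
  simp_rw [h', h, Finset.sum_add_distrib]
  simp

/-- In a thrackle, the smaller endpoints precede all larger endpoints. -/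
theorem IsThrackle.lowerCount_eq {a : OffDiagIndex p →₀ ℕ} (ha : IsThrackle a) (v : Fin p) :
    lowerCount a v = min (∑ e, a e) (lowerCount a v + upperCount a v) := by
  have hle : lowerCount a v ≤ ∑ e, a e :=
    Finset.sum_le_sum_of_subset (Finset.filter_subset _ _)
  -- An edge ending by `v` forces every edge to start by `v`, as a later one would be separated from
  -- it. Otherwise `upperCount a v = 0`.
  by_cases h : ∃ f, a f ≠ 0 ∧ f.1.2 ≤ v
  · obtain ⟨f, hf, hfv⟩ := h
    have : lowerCount a v = ∑ e, a e := by
      refine Finset.sum_subset (Finset.filter_subset _ _) fun e _ he => ?_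
      by_contra hne
      have hm := ha f e hf hne
      refine absurd hm (not_meets_iff.2 (Or.inl ?_))
      simp only [Finset.mem_filter, Finset.mem_univ, true_and, not_le] at he
      exact hfv.trans_lt he
    omega
  · have : upperCount a v = 0 := by
      refine Finset.sum_eq_zero fun e he => ?_
      by_contra hne
      exact h ⟨e, hne, (Finset.mem_filter.1 he).2⟩
    omega

/-- The hypothesis forbids support points in both `S \ T` and `T \ S`, so on the support one set
contains the other. -/
theorem sum_filter_and_eq_min {E : Type*} [Fintype E] (a : E → ℕ) (S T : E → Prop)
    [DecidablePred S] [DecidablePred T]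
    (h : ∀ e f, a e ≠ 0 → a f ≠ 0 → S e → ¬ T e → T f → S f) :
    ∑ e with S e ∧ T e, a e = min (∑ e with S e, a e) (∑ e with T e, a e) := by
  have h₁ : ∑ e with S e ∧ T e, a e ≤ ∑ e with S e, a e :=
    Finset.sum_le_sum_of_subset (Finset.monotone_filter_right _ fun e _ he => he.1)
  have h₂ : ∑ e with S e ∧ T e, a e ≤ ∑ e with T e, a e :=
    Finset.sum_le_sum_of_subset (Finset.monotone_filter_right _ fun e _ he => he.2)
  by_cases hS : ∃ e, a e ≠ 0 ∧ S e ∧ ¬ T e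
  · obtain ⟨e, he, hSe, hTe⟩ := hS
    have : ∑ e with S e ∧ T e, a e = ∑ e with T e, a e := by
      refine Finset.sum_subset (Finset.monotone_filter_right _ fun e _ he => he.2) ?_
      intro f hf hf'
      by_contra hne
      have hTf := (Finset.mem_filter.1 hf).2
      exact hf' (Finset.mem_filter.2 ⟨Finset.mem_univ _, h e f he hne hSe hTe hTf, hTf⟩)
    omega
  · have : ∑ e with S e ∧ T e, a e = ∑ e with S e, a e := by
      refine Finset.sum_subset (Finset.monotone_filter_right _ fun e _ he => he.1) ?_
      intro f hf hf'
      by_contra hne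
      have hSf := (Finset.mem_filter.1 hf).2
      refine hS ⟨f, hne, hSf, fun hTf => hf' (Finset.mem_filter.2 ⟨Finset.mem_univ _, hSf, hTf⟩)⟩
    omega

/-- In a thrackle, smaller and larger endpoints are coupled monotonically. -/
theorem IsThrackle.sum_rectangle {a : OffDiagIndex p →₀ ℕ} (ha : IsThrackle a) (v w : Fin p) :
    ∑ e with e.1.1 ≤ v ∧ e.1.2 ≤ w, a e = min (lowerCount a v) (upperCount a w) := by
  refine sum_filter_and_eq_min a _ _ fun e f he hf hv hw hfw => ?_
  by_contra hfv
  have := ha e f he hf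
  refine absurd this (not_meets_iff.2 (Or.inr (Or.inr (Or.inl ⟨?_, ?_⟩))))
  · exact hv.trans_lt (not_le.1 hfv)
  · exact hfw.trans_lt (not_le.1 hw)

/-- Möbius inversion: in the product order on edges, each rectangle sum is the value at its corner
plus values at smaller edges. -/
theorem eq_of_sum_rectangle_eq {a b : OffDiagIndex p →₀ ℕ}
    (h : ∀ v w, ∑ e with e.1.1 ≤ v ∧ e.1.2 ≤ w, a e = ∑ e with e.1.1 ≤ v ∧ e.1.2 ≤ w, b e) :
    a = b := by
  ext e
  induction e using WellFoundedLT.induction with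
  | ind e ih =>
    have hmem : e ∈ Finset.univ.filter
        (fun f : OffDiagIndex p => f.1.1 ≤ e.1.1 ∧ f.1.2 ≤ e.1.2) := by simp
    have := h e.1.1 e.1.2
    rw [← Finset.add_sum_erase _ _ hmem, ← Finset.add_sum_erase _ _ hmem,
      Finset.sum_congr rfl fun f hf => ih f ?_] at this
    · exact Nat.add_right_cancel this
    · obtain ⟨hne, hf⟩ := Finset.mem_erase.1 hf
      exact lt_of_le_of_ne (Finset.mem_filter.1 hf).2 hne

/-- A thrackle is determined by its vertex degrees. -/
theorem IsThrackle.eq_of_vertexDegree_eq {a b : OffDiagIndex p →₀ ℕ} (ha : IsThrackle a)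
    (hb : IsThrackle b) (h : vertexDegree a = vertexDegree b) : a = b := by
  have htotal : ∑ e, a e = ∑ e, b e := by
    have := sum_vertexDegree a
    rw [h, sum_vertexDegree] at this
    omega
  have hsum (v : Fin p) : lowerCount a v + upperCount a v = lowerCount b v + upperCount b v := by
    rw [← sum_vertexDegree_le, ← sum_vertexDegree_le, h]
  have hlower (v : Fin p) : lowerCount a v = lowerCount b v := by
    rw [ha.lowerCount_eq, hb.lowerCount_eq, htotal, hsum]
  have hupper (v : Fin p) : upperCount a v = upperCount b v := by
    have := hsum v
    have := hlower v
    omega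
  refine eq_of_sum_rectangle_eq fun v w => ?_
  rw [ha.sum_rectangle, hb.sum_rectangle, hlower, hupper]

end FactorAnalysis

/-! ### Refining a weight to a monomial order -/

/-- The additive monoid `σ →₀ ℕ`, to be ordered by a weight first and then by a monomial
order. -/
def MonomialOrder.WeightedSyn {σ : Type*} (_ : MonomialOrder σ) (_ : (σ →₀ ℕ) →+ ℕ) : Type _ :=
  σ →₀ ℕ

namespace MonomialOrder.WeightedSyn

variable {σ : Type*} (m : MonomialOrder σ) (w : (σ →₀ ℕ) →+ ℕ)

noncomputable instance : AddCommMonoid (WeightedSyn m w) :=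
  inferInstanceAs (AddCommMonoid (σ →₀ ℕ))

/-- The order key: the weight, followed by the underlying monomial order. -/
noncomputable def key (a : WeightedSyn m w) : ℕ ×ₗ m.syn :=
  toLex (w a, m.toSyn a)

theorem key_injective : Function.Injective (key m w) := fun _ _ h =>
  m.toSyn.injective (congrArg (fun x => (ofLex x).2) h)

noncomputable instance : LinearOrder (WeightedSyn m w) :=
  LinearOrder.lift' (key m w) (key_injective m w)

theorem le_iff {a b : WeightedSyn m w} :
    a ≤ b ↔ w a < w b ∨ w a = w b ∧ m.toSyn a ≤ m.toSyn b :=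
  Prod.Lex.toLex_le_toLex

theorem lt_iff {a b : WeightedSyn m w} :
    a < b ↔ w a < w b ∨ w a = w b ∧ m.toSyn a < m.toSyn b :=
  Prod.Lex.toLex_lt_toLex

instance : IsOrderedAddMonoid (WeightedSyn m w) where
  add_le_add_left a b h c := by
    have hw (x y : σ →₀ ℕ) : w (x + y) = w x + w y := map_add w x y
    have hm (x y : σ →₀ ℕ) : m.toSyn (x + y) = m.toSyn x + m.toSyn y := map_add m.toSyn x y
    refine (le_iff m w).2 ?_
    refine ((le_iff m w).1 h).imp (fun h => ?_) fun h => ⟨?_, ?_⟩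
    · exact (hw a c).trans_lt ((Nat.add_lt_add_right h _).trans_eq (hw b c).symm)
    · exact (hw a c).trans ((congrArg (· + w c) h.1).trans (hw b c).symm)
    · exact (hm a c).trans_le ((add_le_add_left h.2 _).trans_eq (hm b c).symm)

instance : WellFoundedLT (WeightedSyn m w) :=
  ⟨InvImage.wf (key m w) wellFounded_lt⟩

end MonomialOrder.WeightedSyn

/-- The refinement of a weight by a monomial order. -/
noncomputable def MonomialOrder.weighted {σ : Type*} (m : MonomialOrder σ)
    (w : (σ →₀ ℕ) →+ ℕ) : MonomialOrder σ where
  syn := WeightedSyn m w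
  toSyn := { toEquiv := Equiv.refl (σ →₀ ℕ), map_add' := fun _ _ => rfl }
  toSyn_monotone a b h := by
    refine (WeightedSyn.le_iff m w).2 ?_
    obtain ⟨c, rfl⟩ := exists_add_of_le h
    change w a < w (a + c) ∨ w a = w (a + c) ∧ m.toSyn a ≤ m.toSyn (a + c)
    have := m.toSyn_monotone h
    rw [map_add w]
    rcases Nat.eq_zero_or_pos (w c) with hc | hc
    · exact Or.inr ⟨by omega, this⟩
    · exact Or.inl (by omega)

/-- The lexicographic order needs a linear order on the variables, whereas edges carry only the
product order; any enumeration serves. -/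
theorem MonomialOrder.nonempty_of_finite (σ : Type) [Finite σ] :
    Nonempty (MonomialOrder.{0, 0} σ) := by
  let _ : LinearOrder σ := LinearOrder.lift' (Finite.equivFin σ) (Finite.equivFin σ).injective
  exact ⟨MonomialOrder.lex⟩

/-! ### Thrackle orders and leading terms of tetrads -/

namespace FactorAnalysis

variable {p : ℕ}

theorem exists_isThrackleOrder (p : ℕ) :
    ∃ m : MonomialOrder.{0, 0} (OffDiagIndex p), IsThrackleOrder m := by
  obtain ⟨m⟩ := MonomialOrder.nonempty_of_finite (OffDiagIndex p)
  let w : (OffDiagIndex p →₀ ℕ) →+ ℕ :=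
    Finsupp.liftAddHom fun e => AddMonoidHom.mulRight (thrackleWeight e)
  refine ⟨MonomialOrder.weighted m w, fun a b h => ?_⟩
  exact (MonomialOrder.WeightedSyn.lt_iff _ w).2 (Or.inl h)

open Classical in
theorem thrackleWeight_eq_sum (e : OffDiagIndex p) :
    thrackleWeight e = ∑ f, if Meets e f then 0 else 1 := by
  rw [thrackleWeight, Nat.card_eq_fintype_card, Fintype.card_subtype, Finset.card_filter]
  exact Finset.sum_congr rfl fun f _ => by split_ifs <;> rfl

/-- The edge of the complete graph joining two vertices of a chosen quadruple. -/
def quadEdge (q : Fin 4 ↪o Fin p) (a b : Fin 4) (h : a < b) : OffDiagIndex p :=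
  ⟨(q a, q b), q.strictMono h⟩

/-- The noncrossing pairs of edges on a quadruple `i < j < k < l`: `{ij, kl}` and `{il, jk}`. -/
def noncrossingPair (q : Fin 4 ↪o Fin p) : Bool → OffDiagIndex p × OffDiagIndex p
  | true => (quadEdge q 0 1 (by decide), quadEdge q 2 3 (by decide))
  | false => (quadEdge q 0 3 (by decide), quadEdge q 1 2 (by decide))

/-- The crossing pair of edges on a quadruple `i < j < k < l`: `{ik, jl}`. -/
def crossingPair (q : Fin 4 ↪o Fin p) : OffDiagIndex p × OffDiagIndex p :=
  (quadEdge q 0 2 (by decide), quadEdge q 1 3 (by decide))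

/-- The exponent of the quadratic monomial `ψ_e ψ_f`. -/
noncomputable def pairExponent (x : OffDiagIndex p × OffDiagIndex p) : OffDiagIndex p →₀ ℕ :=
  Finsupp.single x.1 1 + Finsupp.single x.2 1

/-- The tetrad with prescribed noncrossing pair. -/
noncomputable def tetrad (x : (Fin 4 ↪o Fin p) × Bool) : MvPolynomial (OffDiagIndex p) ℝ :=
  monomial (pairExponent (noncrossingPair x.1 x.2)) 1 -
    monomial (pairExponent (crossingPair x.1)) 1

theorem X_mul_X (e f : OffDiagIndex p) :
    (X e * X f : MvPolynomial (OffDiagIndex p) ℝ) = monomial (pairExponent (e, f)) 1 := by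
  simp [X, monomial_mul, pairExponent]

theorem exists_quad {i j k l : Fin p} (hij : i < j) (hjk : j < k) (hkl : k < l) :
    ∃ q : Fin 4 ↪o Fin p, q 0 = i ∧ q 1 = j ∧ q 2 = k ∧ q 3 = l := by
  refine ⟨OrderEmbedding.ofStrictMono ![i, j, k, l] ?_, rfl, rfl, rfl, rfl⟩
  rw [Fin.strictMono_iff_lt_succ]
  intro x
  fin_cases x <;> assumption

theorem quad_lt (q : Fin 4 ↪o Fin p) : q 0 < q 1 ∧ q 1 < q 2 ∧ q 2 < q 3 :=
  ⟨q.strictMono (by decide), q.strictMono (by decide), q.strictMono (by decide)⟩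

theorem tetrads_eq_range (p : ℕ) : tetrads p = Set.range (tetrad (p := p)) := by
  ext f
  constructor
  · rintro ⟨i, j, k, l, hij, hjk, hkl, h⟩
    obtain ⟨q, rfl, rfl, rfl, rfl⟩ := exists_quad hij hjk hkl
    rcases h with rfl | rfl
    · exact ⟨(q, true), by simp only [psi, X_mul_X]; rfl⟩
    · exact ⟨(q, false), by simp only [psi, X_mul_X]; rfl⟩
  · rintro ⟨⟨q, _ | _⟩, rfl⟩ <;>
      refine ⟨q 0, q 1, q 2, q 3, (quad_lt q).1, (quad_lt q).2.1, (quad_lt q).2.2, ?_⟩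
    · right; simp only [psi, X_mul_X]; rfl
    · left; simp only [psi, X_mul_X]; rfl

theorem hasNoncrossingLeadingTerms_iff {m : MonomialOrder.{0, u} (OffDiagIndex p)} :
    HasNoncrossingLeadingTerms m ↔ ∀ x : (Fin 4 ↪o Fin p) × Bool,
      m.leadingTerm (tetrad x) = monomial (pairExponent (noncrossingPair x.1 x.2)) 1 := by
  constructor
  · rintro h ⟨q, b⟩
    have := h _ _ _ _ (quad_lt q).1 (quad_lt q).2.1 (quad_lt q).2.2
    simp only [psi, X_mul_X] at this
    cases b
    · exact this.2
    · exact this.1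
  · intro h i j k l hij hjk hkl
    obtain ⟨q, rfl, rfl, rfl, rfl⟩ := exists_quad hij hjk hkl
    simp only [psi, X_mul_X]
    exact ⟨h (q, true), h (q, false)⟩

theorem HasNoncrossingLeadingTerms.degree_tetrad {m : MonomialOrder.{0, u} (OffDiagIndex p)}
    (hm : HasNoncrossingLeadingTerms m) (x : (Fin 4 ↪o Fin p) × Bool) :
    m.degree (tetrad x) = pairExponent (noncrossingPair x.1 x.2) := by
  have := congrArg m.degree (hasNoncrossingLeadingTerms_iff.1 hm x)
  simpa [MonomialOrder.degree_monomial] using this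

theorem HasNoncrossingLeadingTerms.leadingCoeff_tetrad
    {m : MonomialOrder.{0, u} (OffDiagIndex p)}
    (hm : HasNoncrossingLeadingTerms m) (x : (Fin 4 ↪o Fin p) × Bool) :
    m.leadingCoeff (tetrad x) = 1 := by
  have := congrArg m.leadingCoeff (hasNoncrossingLeadingTerms_iff.1 hm x)
  simpa [MonomialOrder.leadingCoeff_monomial] using this

theorem pairExponent_weight (x : OffDiagIndex p × OffDiagIndex p) :
    ((pairExponent x).sum fun e n => n * thrackleWeight e) =
      thrackleWeight x.1 + thrackleWeight x.2 := by
  rw [pairExponent, Finsupp.sum_add_index' (by simp) (by simp [add_mul])]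
  simp

/-- Replacing a crossing pair of edges by a noncrossing pair on the same four vertices increases
the number of edges missed. -/
theorem thrackleWeight_crossing_lt {e f g h : OffDiagIndex p}
    (hgh : ¬ Meets g h) (heh : Meets e h) (hfh : Meets f h)
    (h₁ : ∀ x, ¬ Meets e x → ¬ Meets g x ∨ ¬ Meets h x)
    (h₂ : ∀ x, ¬ Meets f x → ¬ Meets g x ∨ ¬ Meets h x)
    (h₃ : ∀ x, ¬ Meets e x → ¬ Meets f x → ¬ Meets g x ∧ ¬ Meets h x) :
    thrackleWeight e + thrackleWeight f < thrackleWeight g + thrackleWeight h := by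
  classical
  simp_rw [thrackleWeight_eq_sum, ← Finset.sum_add_distrib]
  -- The comparison is made edge by edge; it is strict at `h`, which misses `g` but meets both `e`
  -- and `f`.
  refine Finset.sum_lt_sum (fun x _ => ?_) ⟨h, Finset.mem_univ _, ?_⟩
  · have := h₁ x
    have := h₂ x
    have := h₃ x
    split_ifs <;> simp_all
  · simp [heh, hfh, hgh]

theorem thrackleWeight_crossingPair_lt (q : Fin 4 ↪o Fin p) (b : Bool) :
    thrackleWeight (crossingPair q).1 + thrackleWeight (crossingPair q).2 <
      thrackleWeight (noncrossingPair q b).1 + thrackleWeight (noncrossingPair q b).2 := by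
  obtain ⟨h01, h12, h23⟩ := quad_lt q
  simp only [Fin.lt_def] at h01 h12 h23
  cases b
  all_goals
    refine thrackleWeight_crossing_lt ?_ ?_ ?_ ?_ ?_ ?_
    · simp only [not_meets_iff, noncrossingPair, quadEdge, Fin.lt_def]
      omega
    · rw [← not_not (a := Meets _ _)]
      simp only [not_meets_iff, noncrossingPair, crossingPair, quadEdge, Fin.lt_def]
      omega
    · rw [← not_not (a := Meets _ _)]
      simp only [not_meets_iff, noncrossingPair, crossingPair, quadEdge, Fin.lt_def]
      omega
    all_goals
      rintro ⟨⟨x, y⟩, hxy⟩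
      change x < y at hxy
      simp only [not_meets_iff, noncrossingPair, crossingPair, quadEdge, Fin.lt_def] at hxy ⊢
      omega

theorem IsThrackleOrder.hasNoncrossingLeadingTerms {m : MonomialOrder.{0, u} (OffDiagIndex p)}
    (hm : IsThrackleOrder m) : HasNoncrossingLeadingTerms m := by
  rw [hasNoncrossingLeadingTerms_iff]
  rintro ⟨q, b⟩
  have hlt := hm (pairExponent (crossingPair q)) (pairExponent (noncrossingPair q b)) (by
    simpa only [pairExponent_weight] using thrackleWeight_crossingPair_lt q b)
  have hdeg : m.degree (monomial (pairExponent (crossingPair q)) (1 : ℝ)) =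
      pairExponent (crossingPair q) := by simp [MonomialOrder.degree_monomial]
  have hdeg' : m.degree (monomial (pairExponent (noncrossingPair q b)) (1 : ℝ)) =
      pairExponent (noncrossingPair q b) := by simp [MonomialOrder.degree_monomial]
  rw [← hdeg, ← hdeg'] at hlt
  rw [MonomialOrder.leadingTerm, tetrad, MonomialOrder.degree_sub_of_lt hlt,
    MonomialOrder.leadingCoeff_sub_of_lt hlt, hdeg', MonomialOrder.leadingCoeff_monomial]

/-! ### Divisibility between the monomials of tetrads -/

theorem eq_or_eq_swap_of_pairExponent_le {x y : OffDiagIndex p × OffDiagIndex p}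
    (hx : x.1 ≠ x.2) (h : pairExponent x ≤ pairExponent y) :
    x.1 = y.1 ∧ x.2 = y.2 ∨ x.1 = y.2 ∧ x.2 = y.1 := by
  have key (e : OffDiagIndex p) (he : e = x.1 ∨ e = x.2) : e = y.1 ∨ e = y.2 := by
    by_contra! hne
    have := h e
    simp only [pairExponent, Finsupp.add_apply, Finsupp.single_apply, hne.1.symm, hne.2.symm,
      if_false] at this
    rcases he with rfl | rfl <;> simp at this
  rcases key x.1 (Or.inl rfl) with h₁ | h₁ <;> rcases key x.2 (Or.inr rfl) with h₂ | h₂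
  · exact absurd (h₁.trans h₂.symm) hx
  · exact Or.inl ⟨h₁, h₂⟩
  · exact Or.inr ⟨h₁, h₂⟩
  · exact absurd (h₁.trans h₂.symm) hx

theorem noncrossingPair_ne (q : Fin 4 ↪o Fin p) (b : Bool) :
    (noncrossingPair q b).1 ≠ (noncrossingPair q b).2 := by
  obtain ⟨h01, h12, h23⟩ := quad_lt q
  simp only [Fin.lt_def] at h01 h12 h23
  cases b <;>
    simp only [noncrossingPair, quadEdge, ne_eq, Subtype.mk.injEq, Prod.mk.injEq, Fin.ext_iff] <;>
    omega

theorem not_noncrossingPair_le_crossingPair (q r : Fin 4 ↪o Fin p) (b : Bool) :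
    ¬ pairExponent (noncrossingPair q b) ≤ pairExponent (crossingPair r) := by
  intro h
  have := eq_or_eq_swap_of_pairExponent_le (noncrossingPair_ne q b) h
  obtain ⟨h01, h12, h23⟩ := quad_lt q
  obtain ⟨k01, k12, k23⟩ := quad_lt r
  simp only [Fin.lt_def] at h01 h12 h23 k01 k12 k23
  cases b <;>
    simp only [noncrossingPair, crossingPair, quadEdge, Subtype.mk.injEq, Prod.mk.injEq,
      Fin.ext_iff] at this <;> omega

/-- The four endpoints and the separated or nested shape recover `(q, b)`. This yields both the
count of tetrads and half of reducedness. -/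
theorem eq_of_noncrossingPair_le {x y : (Fin 4 ↪o Fin p) × Bool}
    (h : pairExponent (noncrossingPair x.1 x.2) ≤ pairExponent (noncrossingPair y.1 y.2)) :
    x = y := by
  obtain ⟨q, b⟩ := x
  obtain ⟨r, c⟩ := y
  have := eq_or_eq_swap_of_pairExponent_le (noncrossingPair_ne q b) h
  obtain ⟨h01, h12, h23⟩ := quad_lt q
  obtain ⟨k01, k12, k23⟩ := quad_lt r
  simp only [Fin.lt_def] at h01 h12 h23 k01 k12 k23
  suffices b = c ∧ (q 0).val = r 0 ∧ (q 1).val = r 1 ∧ (q 2).val = r 2 ∧ (q 3).val = r 3 by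
    obtain ⟨rfl, h0, h1, h2, h3⟩ := this
    refine Prod.ext (DFunLike.ext _ _ fun i => Fin.ext ?_) rfl
    fin_cases i <;> assumption
  cases b <;> cases c <;>
    simp only [noncrossingPair, quadEdge, Subtype.mk.injEq, Prod.mk.injEq, Fin.ext_iff,
      true_and, reduceCtorEq, false_and] at this ⊢ <;> omega

theorem exists_noncrossingPair_of_not_meets {e f : OffDiagIndex p} (h : ¬ Meets e f) :
    ∃ x : (Fin 4 ↪o Fin p) × Bool,
      pairExponent (noncrossingPair x.1 x.2) = pairExponent (e, f) := by
  have hcomm (a b : OffDiagIndex p) : pairExponent (a, b) = pairExponent (b, a) := add_comm _ _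
  rcases not_meets_iff.1 h with h | h | ⟨h, h'⟩ | ⟨h, h'⟩
  · obtain ⟨q, h0, h1, h2, h3⟩ := exists_quad e.2 h f.2
    exact ⟨(q, true), by simp [noncrossingPair, quadEdge, h0, h1, h2, h3]⟩
  · obtain ⟨q, h0, h1, h2, h3⟩ := exists_quad f.2 h e.2
    exact ⟨(q, true), by rw [hcomm]; simp [noncrossingPair, quadEdge, h0, h1, h2, h3]⟩
  · obtain ⟨q, h0, h1, h2, h3⟩ := exists_quad h f.2 h'
    exact ⟨(q, false), by simp [noncrossingPair, quadEdge, h0, h1, h2, h3]⟩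
  · obtain ⟨q, h0, h1, h2, h3⟩ := exists_quad h e.2 h'
    exact ⟨(q, false), by rw [hcomm]; simp [noncrossingPair, quadEdge, h0, h1, h2, h3]⟩

theorem tetrad_injective (p : ℕ) : Function.Injective (tetrad (p := p)) := by
  obtain ⟨m, hm⟩ := exists_isThrackleOrder p
  intro x y h
  have := congrArg m.degree h
  rw [hm.hasNoncrossingLeadingTerms.degree_tetrad,
    hm.hasNoncrossingLeadingTerms.degree_tetrad] at this
  exact eq_of_noncrossingPair_le this.le

theorem ncard_tetrads (p : ℕ) : (tetrads p).ncard = 2 * p.choose 4 := by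
  rw [tetrads_eq_range, ← Set.image_univ, Set.ncard_image_of_injective _ (tetrad_injective p),
    Set.ncard_univ, Nat.card_prod, Nat.card_congr Set.powersetCard.ofFinEmbEquiv,
    Set.powersetCard.card]
  simp [mul_comm]

theorem finite_tetrads (p : ℕ) : (tetrads p).Finite := by
  rw [tetrads_eq_range]
  exact Set.finite_range _

/-! ### Gröbner bases from normal forms -/

/-- A finite set of monic elements of `I` such that no nonzero element of `I` is in normal form is
a Gröbner basis of `I`, and it generates `I`. -/
theorem isGroebnerBasis_of_normalForm {σ K : Type*} [Field K] (m : MonomialOrder σ)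
    {G : Set (MvPolynomial σ K)} {I : Ideal (MvPolynomial σ K)} (hfin : G.Finite)
    (hG : G ⊆ I) (hlc : ∀ g ∈ G, m.leadingCoeff g = 1)
    (hnf : ∀ r ∈ I, (∀ c ∈ r.support, ∀ g ∈ G, ¬ m.degree g ≤ c) → r = 0) :
    I = Ideal.span G ∧ IsGroebnerBasis m G I := by
  have hdiv (f : MvPolynomial σ K) (hf : f ∈ I) : ∃ g : G →₀ MvPolynomial σ K,
      f = g.sum (fun b c => c * (b : MvPolynomial σ K)) ∧
      ∀ b : G, m.toSyn (m.degree ((b : MvPolynomial σ K) * g b)) ≤ m.toSyn (m.degree f) := by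
    obtain ⟨g, r, hfr, hdeg, hr⟩ :=
      m.div_set (fun b hb => (hlc b hb).symm ▸ isUnit_one) f
    rw [Finsupp.linearCombination_apply] at hfr
    simp only [smul_eq_mul] at hfr
    -- The remainder lies in `I` and is in normal form.
    have hr0 : r = 0 := by
      refine hnf r ?_ hr
      have : r = f - g.sum (fun b c => c * (b : MvPolynomial σ K)) :=
        eq_sub_of_add_eq' hfr.symm
      rw [this]
      exact I.sub_mem hf (I.sum_mem fun b _ => I.mul_mem_left _ (hG b.2))
    exact ⟨g, by rw [hfr, hr0, add_zero], hdeg⟩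
  refine ⟨le_antisymm (fun f hf => ?_) (Ideal.span_le.2 hG), hfin, hG, le_antisymm
    (Ideal.span_mono (Set.image_mono hG)) (Ideal.span_le.2 ?_)⟩
  · obtain ⟨g, hfg, -⟩ := hdiv f hf
    rw [hfg]
    exact Ideal.sum_mem _ fun b _ => Ideal.mul_mem_left _ _ (Ideal.subset_span b.2)
  · rintro _ ⟨f, hf, rfl⟩
    by_cases hf0 : f = 0
    · rw [hf0, MonomialOrder.leadingTerm_zero]
      exact Submodule.zero_mem _
    obtain ⟨g, hfg, hdeg⟩ := hdiv f hf
    have hc : f.coeff (m.degree f) ≠ 0 := m.coeff_degree_ne_zero_iff.2 hf0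
    -- The leading monomial of `f` survives in some summand, whose degree is at most that of `f`;
    -- hence the two degrees agree.
    obtain ⟨b, hb⟩ : ∃ b : G, (g b * (b : MvPolynomial σ K)).coeff (m.degree f) ≠ 0 := by
      by_contra! h
      refine hc ((congrArg (coeff (m.degree f)) hfg).trans ?_)
      rw [Finsupp.sum, coeff_sum]
      exact Finset.sum_eq_zero fun b _ => h b
    have hprod : g b * (b : MvPolynomial σ K) ≠ 0 := fun h => hb (by rw [h, coeff_zero])
    have heq : m.degree f = m.degree (g b * (b : MvPolynomial σ K)) := by
      refine m.toSyn.injective (le_antisymm (m.le_degree (mem_support_iff.2 hb)) ?_)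
      rw [mul_comm]
      exact hdeg b
    have hmem : m.leadingTerm (b : MvPolynomial σ K) ∈ Ideal.span (m.leadingTerm '' G) :=
      Ideal.subset_span ⟨b, b.2, rfl⟩
    have : m.leadingTerm f = monomial (m.degree (g b)) (m.leadingCoeff f) *
        m.leadingTerm (b : MvPolynomial σ K) := by
      rw [MonomialOrder.leadingTerm, MonomialOrder.leadingTerm, monomial_mul, hlc _ b.2, mul_one,
        heq, m.degree_mul (left_ne_zero_of_mul hprod) (right_ne_zero_of_mul hprod)]
    rw [SetLike.mem_coe, this]
    exact Ideal.mul_mem_left _ _ hmem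

/-! ### The off-diagonal invariants as a toric ideal -/

/-- The off-diagonal entries of the rank one matrix `t tᵗ`. -/
def rankOne (t : Fin p → ℝ) (e : OffDiagIndex p) : ℝ := t e.1.1 * t e.1.2

theorem mem_parameterSpace_one_iff {Ψ : Matrix (Fin p) (Fin p) ℝ} :
    Ψ ∈ parameterSpace p 1 ↔ ∃ s t : Fin p → ℝ, (∀ i, 0 < s i) ∧
      Ψ = Matrix.diagonal s + Matrix.of fun i j => t i * t j := by
  constructor
  · rintro ⟨S, L, hS, hpos, rfl⟩
    refine ⟨S.diag, fun i => L i 0, fun i => hpos.diag_pos, ?_⟩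
    rw [hS.diagonal_diag]
    congr 1
    ext i j
    simp [Matrix.mul_apply]
  · rintro ⟨s, t, hs, rfl⟩
    refine ⟨Matrix.diagonal s, Matrix.of fun i _ => t i, Matrix.isDiag_diagonal s,
      Matrix.PosDef.diagonal hs, ?_⟩
    congr 1
    ext i j
    simp [Matrix.mul_apply]

theorem evalAt_inclusion (Ψ : Matrix (Fin p) (Fin p) ℝ) (f : MvPolynomial (OffDiagIndex p) ℝ) :
    evalAt Ψ (inclusion p f) = eval (fun e : OffDiagIndex p => Ψ e.1.1 e.1.2) f := by
  rw [evalAt, inclusion, eval_rename]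
  rfl

theorem mem_invariantIdeal_one_iff {f : MvPolynomial (OffDiagIndex p) ℝ} :
    f ∈ invariantIdeal p 1 ↔ ∀ t : Fin p → ℝ, eval (rankOne t) f = 0 := by
  have hoff (s t : Fin p → ℝ) : (fun e : OffDiagIndex p => (Matrix.diagonal s +
      Matrix.of fun i j => t i * t j) e.1.1 e.1.2) = rankOne t := by
    ext e
    simp [rankOne, Matrix.diagonal_apply_ne _ e.2.ne]
  constructor
  · intro h t
    have : evalAt _ (inclusion p f) = 0 :=
      h _ (mem_parameterSpace_one_iff.2 ⟨1, t, fun _ => one_pos, rfl⟩)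
    rwa [evalAt_inclusion, hoff] at this
  · intro h Ψ hΨ
    obtain ⟨s, t, -, rfl⟩ := mem_parameterSpace_one_iff.1 hΨ
    rw [evalAt_inclusion, hoff]
    exact h t

/-- The monomial parametrization `ψ_{ij} ↦ x_i x_j`. -/
noncomputable def toricMap (p : ℕ) :
    MvPolynomial (OffDiagIndex p) ℝ →ₐ[ℝ] MvPolynomial (Fin p) ℝ :=
  aeval fun e => X e.1.1 * X e.1.2

theorem toricMap_monomial (a : OffDiagIndex p →₀ ℕ) (c : ℝ) :
    toricMap p (monomial a c) = monomial (vertexDegree a) c := by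
  rw [toricMap, aeval_monomial, vertexDegree, Finsupp.sum, Finsupp.prod,
    ← mul_one c, ← C_mul_monomial, monomial_sum_one]
  congr 1
  · simp
  · refine Finset.prod_congr rfl fun e _ => ?_
    simp [X, monomial_mul, monomial_pow]

/-- Evaluating at `t tᵗ` is evaluating the toric image at `t`, and a polynomial vanishing on all of
`ℝᵖ` is zero. -/
theorem mem_invariantIdeal_one_iff_toricMap {f : MvPolynomial (OffDiagIndex p) ℝ} :
    f ∈ invariantIdeal p 1 ↔ toricMap p f = 0 := by
  have h (t : Fin p → ℝ) : eval t (toricMap p f) = eval (rankOne t) f := by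
    have : (aeval t : MvPolynomial (Fin p) ℝ →ₐ[ℝ] ℝ).comp (toricMap p) = aeval (rankOne t) := by
      ext e
      simp [toricMap, rankOne]
    exact DFunLike.congr_fun this f
  rw [mem_invariantIdeal_one_iff, MvPolynomial.funext_iff]
  simp [h]

theorem toricMap_coeff (f : MvPolynomial (OffDiagIndex p) ℝ) (d : Fin p →₀ ℕ) :
    (toricMap p f).coeff d = ∑ a ∈ f.support, if vertexDegree a = d then f.coeff a else 0 := by
  conv_lhs => rw [f.as_sum, map_sum, coeff_sum]
  simp only [toricMap_monomial, coeff_monomial]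

/-- An invariant all of whose monomials are thrackles vanishes. -/
theorem eq_zero_of_isThrackle {f : MvPolynomial (OffDiagIndex p) ℝ}
    (hf : f ∈ invariantIdeal p 1) (h : ∀ a ∈ f.support, IsThrackle a) : f = 0 := by
  by_contra hne
  obtain ⟨a, ha⟩ := support_nonempty.2 hne
  -- No other monomial of `f` has these vertex degrees, so this coefficient of the image is `f.coeff
  -- a`.
  have h0 := toricMap_coeff f (vertexDegree a)
  rw [mem_invariantIdeal_one_iff_toricMap.1 hf, coeff_zero, Finset.sum_eq_single_of_mem a ha,
    if_pos rfl] at h0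
  · exact mem_support_iff.1 ha h0.symm
  · intro b hb hba
    exact if_neg fun hd => hba ((h b hb).eq_of_vertexDegree_eq (h a ha) hd)

theorem tetrad_mem_invariantIdeal (x : (Fin 4 ↪o Fin p) × Bool) :
    tetrad x ∈ invariantIdeal p 1 := by
  rw [mem_invariantIdeal_one_iff]
  intro t
  obtain ⟨q, b⟩ := x
  rw [tetrad, pairExponent, pairExponent]
  cases b <;>
    simp [eval_monomial, Finsupp.prod_add_index', pow_add, noncrossingPair, crossingPair,
      quadEdge, rankOne] <;> ring

/-! ### The tetrads as reduced Gröbner basis -/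

theorem HasNoncrossingLeadingTerms.isThrackle {m : MonomialOrder.{0, u} (OffDiagIndex p)}
    (hm : HasNoncrossingLeadingTerms m) {a : OffDiagIndex p →₀ ℕ}
    (ha : ∀ g ∈ tetrads p, ¬ m.degree g ≤ a) : IsThrackle a := by
  intro e f he hf
  by_contra hef
  obtain ⟨x, hx⟩ := exists_noncrossingPair_of_not_meets hef
  refine ha (tetrad x) (tetrads_eq_range p ▸ ⟨x, rfl⟩) ?_
  rw [hm.degree_tetrad, hx]
  -- An edge meets itself, so `ψ_e ψ_f` is squarefree and positive exponents at `e` and `f` suffice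
  -- for divisibility.
  have hne : e ≠ f := by
    rintro rfl
    exact hef (Or.inl (Or.inl rfl))
  intro g
  simp only [pairExponent, Finsupp.add_apply, Finsupp.single_apply]
  split_ifs with h₁ h₂ h₂
  · exact absurd (h₁.trans h₂.symm) hne
  · subst h₁; omega
  · subst h₂; omega
  · omega

theorem HasNoncrossingLeadingTerms.isGroebnerBasis {m : MonomialOrder.{0, u} (OffDiagIndex p)}
    (hm : HasNoncrossingLeadingTerms m) :
    invariantIdeal p 1 = Ideal.span (tetrads p) ∧
      IsGroebnerBasis m (tetrads p) (invariantIdeal p 1) := by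
  refine isGroebnerBasis_of_normalForm m (finite_tetrads p) ?_ ?_ fun r hr h =>
    eq_zero_of_isThrackle hr fun a ha => hm.isThrackle (h a ha)
  · rw [tetrads_eq_range]
    rintro _ ⟨x, rfl⟩
    exact tetrad_mem_invariantIdeal x
  · rw [tetrads_eq_range]
    rintro _ ⟨x, rfl⟩
    exact hm.leadingCoeff_tetrad x

theorem HasNoncrossingLeadingTerms.isReducedGroebnerBasis
    {m : MonomialOrder.{0, u} (OffDiagIndex p)} (hm : HasNoncrossingLeadingTerms m) :
    IsReducedGroebnerBasis m (tetrads p) (invariantIdeal p 1) := by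
  refine ⟨hm.isGroebnerBasis.2, ?_, ?_⟩
  · rw [tetrads_eq_range]
    rintro _ ⟨x, rfl⟩
    exact hm.leadingCoeff_tetrad x
  rw [tetrads_eq_range]
  rintro _ ⟨x, rfl⟩ d hd hmem
  -- The other leading terms span a monomial ideal, where membership of `d` means divisibility by
  -- one of them.
  have hle : m.leadingTerm '' (Set.range tetrad \ {tetrad x}) ⊆
      (fun s => monomial s (1 : ℝ)) ''
        ((fun y => pairExponent (noncrossingPair y.1 y.2)) '' {y | y ≠ x}) := by
    rintro _ ⟨_, ⟨⟨y, rfl⟩, hy⟩, rfl⟩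
    refine ⟨_, ⟨y, fun h => hy (congrArg tetrad h), rfl⟩, ?_⟩
    exact (hasNoncrossingLeadingTerms_iff.1 hm y).symm
  obtain ⟨_, ⟨y, hyx, rfl⟩, hyd⟩ :=
    mem_ideal_span_monomial_image.1 (Ideal.span_mono hle hmem) d (by simp)
  have hd' : d = pairExponent (noncrossingPair x.1 x.2) ∨ d = pairExponent (crossingPair x.1) := by
    by_contra! hne
    refine mem_support_iff.1 hd ?_
    simp [tetrad, coeff_monomial, hne.1.symm, hne.2.symm]
  rcases hd' with rfl | rfl
  · exact hyx (eq_of_noncrossingPair_le hyd)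
  · exact not_noncrossingPair_le_crossingPair _ _ _ hyd

theorem invariantIdeal_one_eq_span (p : ℕ) : invariantIdeal p 1 = Ideal.span (tetrads p) := by
  obtain ⟨m, hm⟩ := exists_isThrackleOrder p
  exact hm.hasNoncrossingLeadingTerms.isGroebnerBasis.1

/-! ### Adjoining the diagonal unknowns -/

/-- Separate the diagonal from the off-diagonal unknowns. -/
noncomputable def splitDiagonal (p : ℕ) :
    MvPolynomial (UpperIndex p) ℝ →ₐ[ℝ] MvPolynomial (Fin p) (MvPolynomial (OffDiagIndex p) ℝ) :=
  aeval fun e => if h : e.1.1 < e.1.2 then C (X ⟨e.1, h⟩) else X e.1.1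

/-- The inverse of `splitDiagonal`. -/
noncomputable def mergeDiagonal (p : ℕ) :
    MvPolynomial (Fin p) (MvPolynomial (OffDiagIndex p) ℝ) →+* MvPolynomial (UpperIndex p) ℝ :=
  eval₂Hom (inclusion p : _ →+* _) fun i => X ⟨(i, i), le_rfl⟩

theorem mergeDiagonal_splitDiagonal (f : MvPolynomial (UpperIndex p) ℝ) :
    mergeDiagonal p (splitDiagonal p f) = f := by
  have : (mergeDiagonal p).comp (splitDiagonal p : _ →+* _) = RingHom.id _ := by
    refine MvPolynomial.ringHom_ext (fun r => ?_) fun e => ?_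
    · simp [mergeDiagonal, splitDiagonal, inclusion, MvPolynomial.algebraMap_apply]
    · obtain ⟨⟨i, j⟩, hij⟩ := e
      by_cases h : i < j
      · simp [mergeDiagonal, splitDiagonal, inclusion, h]
      · obtain rfl : i = j := le_antisymm hij (not_lt.1 h)
        simp [mergeDiagonal, splitDiagonal]
  exact DFunLike.congr_fun this f

theorem eval_splitDiagonal (f : MvPolynomial (UpperIndex p) ℝ) (d t : Fin p → ℝ) :
    eval d (map (eval (rankOne t)) (splitDiagonal p f)) =
      evalAt (Matrix.diagonal (fun i => d i - t i * t i) + Matrix.of fun i j => t i * t j) f := by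
  have : ((eval d).comp (map (eval (rankOne t)))).comp (splitDiagonal p : _ →+* _) =
      evalAt (Matrix.diagonal (fun i => d i - t i * t i) + Matrix.of fun i j => t i * t j) := by
    refine MvPolynomial.ringHom_ext (fun r => ?_) fun e => ?_
    · simp [evalAt, splitDiagonal, MvPolynomial.algebraMap_apply]
    · obtain ⟨⟨i, j⟩, hij⟩ := e
      by_cases h : i < j
      · simp [evalAt, splitDiagonal, h, rankOne, Matrix.diagonal_apply_ne _ h.ne]
      · obtain rfl : i = j := le_antisymm hij (not_lt.1 h)
        simp [evalAt, splitDiagonal]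
  exact DFunLike.congr_fun this f

theorem coeff_splitDiagonal_mem {f : MvPolynomial (UpperIndex p) ℝ}
    (hf : f ∈ vanishingIdeal (parameterSpace p 1)) (d : Fin p →₀ ℕ) :
    (splitDiagonal p f).coeff d ∈ invariantIdeal p 1 := by
  rw [mem_invariantIdeal_one_iff]
  intro t
  have h : map (eval (rankOne t)) (splitDiagonal p f) = 0 := by
    -- Positivity of `Σ` requires only `d i > t i * t i`, which leaves an infinite set for each
    -- diagonal entry.
    refine MvPolynomial.funext_set (fun i => Set.Ioi (t i * t i))
      (fun i => Set.Ioi_infinite _) fun d hd => ?_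
    rw [eval_splitDiagonal, map_zero]
    exact hf _ (mem_parameterSpace_one_iff.2
      ⟨_, t, fun i => sub_pos.2 (hd i (Set.mem_univ i)), rfl⟩)
  rw [← coeff_map, h, coeff_zero]

theorem vanishingIdeal_one_eq_span (p : ℕ) :
    vanishingIdeal (parameterSpace p 1) = Ideal.span (inclusion p '' tetrads p) := by
  refine le_antisymm (fun f hf => ?_) (Ideal.span_le.2 ?_)
  · have hmem : splitDiagonal p f ∈ (Ideal.span (tetrads p)).map C := by
      rw [mem_map_C_iff, ← invariantIdeal_one_eq_span]
      exact coeff_splitDiagonal_mem hf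
    have := Ideal.mem_map_of_mem (mergeDiagonal p) hmem
    rw [mergeDiagonal_splitDiagonal, Ideal.map_map, Ideal.map_span] at this
    convert this using 3
    ext f
    simp [mergeDiagonal]
  · rintro _ ⟨f, hf, rfl⟩
    exact (invariantIdeal_one_eq_span p).ge (Ideal.subset_span hf)

theorem invariantIdeal_one_eq_bot (hp : p ≤ 3) : invariantIdeal p 1 = ⊥ := by
  have : IsEmpty (Fin 4 ↪o Fin p) :=
    ⟨fun q => by
      have := Fintype.card_le_of_injective q q.injective
      simp only [Fintype.card_fin] at this
      omega⟩
  rw [invariantIdeal_one_eq_span, tetrads_eq_range, Set.range_eq_empty, Ideal.span_empty]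

end FactorAnalysis

theorem theorem5p1 (p : ℕ) :
    (p ≤ 3 → FactorAnalysis.invariantIdeal p 1 = ⊥) ∧
    (4 ≤ p →
      (FactorAnalysis.tetrads p).ncard = 2 * p.choose 4 ∧
      (∃ m : MonomialOrder.{0, 0} (FactorAnalysis.OffDiagIndex p),
        FactorAnalysis.IsThrackleOrder m) ∧
      (∀ m : MonomialOrder.{0, u} (FactorAnalysis.OffDiagIndex p),
        FactorAnalysis.IsThrackleOrder m →
          FactorAnalysis.HasNoncrossingLeadingTerms m ∧
          FactorAnalysis.IsReducedGroebnerBasis m (FactorAnalysis.tetrads p)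
            (FactorAnalysis.invariantIdeal p 1)) ∧
      (∀ m : MonomialOrder.{0, u} (FactorAnalysis.OffDiagIndex p),
        FactorAnalysis.HasNoncrossingLeadingTerms m →
          FactorAnalysis.IsReducedGroebnerBasis m (FactorAnalysis.tetrads p)
            (FactorAnalysis.invariantIdeal p 1))) ∧
    FactorAnalysis.invariantIdeal p 1 = Ideal.span (FactorAnalysis.tetrads p) ∧
    FactorAnalysis.vanishingIdeal (FactorAnalysis.parameterSpace p 1) =
      Ideal.span (FactorAnalysis.inclusion p '' FactorAnalysis.tetrads p) :=
  ⟨FactorAnalysis.invariantIdeal_one_eq_bot,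
    fun _ => ⟨FactorAnalysis.ncard_tetrads p, FactorAnalysis.exists_isThrackleOrder p,
      fun _ hm => ⟨hm.hasNoncrossingLeadingTerms,
        hm.hasNoncrossingLeadingTerms.isReducedGroebnerBasis⟩,
      fun _ hm => hm.isReducedGroebnerBasis⟩,
    FactorAnalysis.invariantIdeal_one_eq_span p, FactorAnalysis.vanishingIdeal_one_eq_span p⟩
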